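/- **Setting.** There are $N$ agents and an unknown $\mu\in\mathbb R$. At each time $t=0,1,2,\dots$ agent $i$ observes $o_{i,t}\sim\mathcal N(\mu,\sigma^2)$, $\sigma>0$, independently over $i$ and $t$. Agent $i$'s private belief at time $t$ has mean $\hat\mu_{i,t}=\frac1t\sum_{s<t}o_{i,s}$ and precision $p_{i,t}=t\sigma^{-2}$. The aggregate beliefs, with means $\hat{\boldsymbol\nu}_t$ and precisions $\boldsymbol q_t$, start from arbitrary deterministic $\boldsymbol q_0\ge 0$ and $\hat{\boldsymbol\nu}_0\in\mathbb R^N$ and evolve by $$\boldsymbol q_{t+1}=\boldsymbol p_{t+1}+W(t)\boldsymbol q_t,\qquad \hat{\boldsymbol\nu}_{t+1}\odot\boldsymbol q_{t+1}=\hat{\boldsymbol\mu}_{t+1}\odot\boldsymbol p_{t+1}+W(t)(\hat{\boldsymbol\nu}_t\odot\boldsymbol q_t),$$ where $\odot$ is the entrywise product and $W(t)_{k,i}\ge 0$ is the trust of agent $k$ in agent $i$. Write $\|A\|_1=\max_j\sum_i|A_{ij}|$ for matrices, $|x|_1=\sum_i|x_i|$ for vectors and $\rho$ for the spectral radius. **Corollary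 (lock-in under time-varying trust with constant incoming trust).** There is a positive-valued function $h(c,L,U,N,\delta)$ with the following property. Let $\epsilon>0$, $c>1$, $0<L<U<\infty$, $\delta>0$, and let $W(t)$, $t=0,1,2,\dots$, be non-negative primitive $N\times N$ matrices such that for all $t$ 1. $\|W(t+1)-W(t)\|_1\le\epsilon$; 2. $\rho(W(t))\ge c$; 3. every non-zero entry of $W(t)$ lies in $[L,U]$; 4. every complex eigenvalue of $W(t)$ other than the leading eigenvalue $\rho(W(t))$ has modulus at most $1-\delta$; 5. each agent receives the same total trust, i.e. all column sums $\sum_k W(t)_{k,i}$ ($i=1,\dots,N$) are equal (their common value may depend on $t$); 6. for any two distinct agents $i,j$ there is an agent $k$ with $W(t)_{k,i}W(t)_{k,j}>0$. Then: (a) if $v(t)$ denotes a Perron vector of $W(t)$ (a positive eigenvector for $\rho(W(t))$), then $\left|\frac{v(t+1)}{|v(t+1)|_1}-\frac{v(t)}{|v(t)|_1}\right|_1\le\frac{2\epsilon}{L}$ for all $t$; (b) if $\epsilon<h(c,L,U,N,\delta)$, then for every agent $i$, $\Pr\left[\lim_{t\to\infty}\hat\nu_{i,t}=\mu\right]=0$.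 -/

import Mathlib

open MeasureTheory ProbabilityTheory Filter Topology

namespace TrustDynamics

noncomputable section

/-! ### Matrices -/

/-- The matrix norm `‖A‖₁` induced by the vector 1-norm, i.e. the largest absolute column sum. -/
def matrixOneNorm {N : ℕ} (A : Matrix (Fin N) (Fin N) ℝ) : ℝ :=
  ⨆ j, ∑ i, |A i j|

/-- The vector 1-norm. -/
def vecOneNorm {N : ℕ} (v : Fin N → ℝ) : ℝ :=
  ∑ i, |v i|

/-- A real matrix regarded as a complex one. -/
def toComplex {N : ℕ} (A : Matrix (Fin N) (Fin N) ℝ) : Matrix (Fin N) (Fin N) ℂ :=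
  A.map (fun x => (x : ℂ))

/-- The spectral radius: the largest modulus of a complex eigenvalue. -/
def rho {N : ℕ} (A : Matrix (Fin N) (Fin N) ℝ) : ℝ :=
  (spectralRadius ℂ (toComplex A)).toReal

/-- Perron vectors: entrywise positive eigenvectors for the eigenvalue `ρ(A)`. -/
def IsPerronVector {N : ℕ} (A : Matrix (Fin N) (Fin N) ℝ) (v : Fin N → ℝ) : Prop :=
  (∀ i, 0 < v i) ∧ A.mulVec v = rho A • v

/-- A vector divided by its 1-norm. -/
def normalized {N : ℕ} (v : Fin N → ℝ) : Fin N → ℝ :=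
  fun i => v i / vecOneNorm v

/-- The standing conditions on a sequence of trust matrices: non-negative primitive matrices with
slow drift, spectral radius bounded below by `c`, non-zero entries in `[L, U]`, and all
eigenvalues other than the leading one of modulus at most `1 - δ`. -/
structure SlowPrimitiveTrust {N : ℕ} (W : ℕ → Matrix (Fin N) (Fin N) ℝ)
    (ε c L U δ : ℝ) : Prop where
  primitive : ∀ t, (W t).IsPrimitive
  drift : ∀ t, matrixOneNorm (W (t + 1) - W t) ≤ ε
  radius : ∀ t, c ≤ rho (W t)
  entries : ∀ t i j, W t i j ≠ 0 → L ≤ W t i j ∧ W t i j ≤ U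
  subdominant : ∀ t, ∀ z ∈ spectrum ℂ (toComplex (W t)), z ≠ (rho (W t) : ℂ) → ‖z‖ ≤ 1 - δ

/-- Every agent receives the same total trust: all column sums of `A` coincide. -/
def EqualIncomingTrust {N : ℕ} (A : Matrix (Fin N) (Fin N) ℝ) : Prop :=
  ∃ s : ℝ, ∀ j, ∑ i, A i j = s

/-- Any two agents are trusted by a common agent. -/
def CommonTruster {N : ℕ} (A : Matrix (Fin N) (Fin N) ℝ) : Prop :=
  ∀ i j, i ≠ j → ∃ k, 0 < A k i * A k j

/-! ### Belief dynamics

`o t i` is the measurement of agent `i` at time `t`. -/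

/-- The precision `t σ⁻²` of the private beliefs at time `t`. -/
def privatePrecision (σ : ℝ) (t : ℕ) : ℝ :=
  t * (σ ^ 2)⁻¹

/-- The mean of the private belief of agent `i` at time `t`: the average of its first `t`
measurements (at `t = 0` the precision is zero, so the value there plays no role). -/
def privateMean {N : ℕ} {Ω : Type*} (o : ℕ → Fin N → Ω → ℝ) (t : ℕ) (i : Fin N) (ω : Ω) : ℝ :=
  (∑ s ∈ Finset.range t, o s i ω) / t

/-- The precisions of the aggregate beliefs, started at `q₀`. -/
def aggPrecision {N : ℕ} (W : ℕ → Matrix (Fin N) (Fin N) ℝ) (σ : ℝ) (q₀ : Fin N → ℝ) :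
    ℕ → Fin N → ℝ
  | 0 => q₀
  | t + 1 => fun i => privatePrecision σ (t + 1) + ∑ j, W t i j * aggPrecision W σ q₀ t j

/-- The means of the aggregate beliefs, started at `ν₀`. -/
def aggMean {N : ℕ} {Ω : Type*} (W : ℕ → Matrix (Fin N) (Fin N) ℝ) (σ : ℝ) (q₀ ν₀ : Fin N → ℝ)
    (o : ℕ → Fin N → Ω → ℝ) : ℕ → Fin N → Ω → ℝ
  | 0 => fun i _ => ν₀ i
  | t + 1 => fun i ω =>
      (privateMean o (t + 1) i ω * privatePrecision σ (t + 1)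
        + ∑ j, W t i j * (aggMean W σ q₀ ν₀ o t j ω * aggPrecision W σ q₀ t j))
      / aggPrecision W σ q₀ (t + 1) i

/-! The four transition equations of the dynamics. -/

theorem privatePrecision_succ (σ : ℝ) (t : ℕ) :
    privatePrecision σ (t + 1) = privatePrecision σ t + (σ ^ 2)⁻¹ := by
  simp only [privatePrecision]; push_cast; ring

theorem privateMean_succ {N : ℕ} {Ω : Type*} (o : ℕ → Fin N → Ω → ℝ) (σ : ℝ) (t : ℕ) (i : Fin N)
    (ω : Ω) :
    privateMean o (t + 1) i ω * privatePrecision σ (t + 1)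
      = privateMean o t i ω * privatePrecision σ t + (σ ^ 2)⁻¹ * o t i ω := by
  have key : ∀ t : ℕ, privateMean o t i ω * privatePrecision σ t
      = (σ ^ 2)⁻¹ * ∑ s ∈ Finset.range t, o s i ω := by
    intro t
    rcases Nat.eq_zero_or_pos t with rfl | ht
    · simp [privateMean, privatePrecision]
    · have : (t : ℝ) ≠ 0 := by exact_mod_cast ht.ne'
      simp only [privateMean, privatePrecision]
      field_simp
  rw [key, key, Finset.sum_range_succ, mul_add]

theorem aggPrecision_succ {N : ℕ} (W : ℕ → Matrix (Fin N) (Fin N) ℝ) (σ : ℝ) (q₀ : Fin N → ℝ)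
    (t : ℕ) (i : Fin N) :
    aggPrecision W σ q₀ (t + 1) i
      = privatePrecision σ (t + 1) + (W t).mulVec (aggPrecision W σ q₀ t) i := rfl

theorem aggPrecision_nonneg {N : ℕ} {W : ℕ → Matrix (Fin N) (Fin N) ℝ} (σ : ℝ)
    {q₀ : Fin N → ℝ} (hW : ∀ t i j, 0 ≤ W t i j) (hq : ∀ i, 0 ≤ q₀ i) (t : ℕ) (i : Fin N) :
    0 ≤ aggPrecision W σ q₀ t i := by
  induction t generalizing i with
  | zero => exact hq i
  | succ t ih =>
    have h1 : 0 ≤ privatePrecision σ (t + 1) := by unfold privatePrecision; positivity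
    exact add_nonneg h1 (Finset.sum_nonneg fun j _ => mul_nonneg (hW t i j) (ih j))

theorem aggPrecision_succ_pos {N : ℕ} {W : ℕ → Matrix (Fin N) (Fin N) ℝ} {σ : ℝ} (hσ : 0 < σ)
    {q₀ : Fin N → ℝ} (hW : ∀ t i j, 0 ≤ W t i j) (hq : ∀ i, 0 ≤ q₀ i) (t : ℕ) (i : Fin N) :
    0 < aggPrecision W σ q₀ (t + 1) i := by
  have h1 : 0 < privatePrecision σ (t + 1) := by unfold privatePrecision; positivity
  exact add_pos_of_pos_of_nonneg h1
    (Finset.sum_nonneg fun j _ => mul_nonneg (hW t i j) (aggPrecision_nonneg σ hW hq t j))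

theorem aggMean_succ {N : ℕ} {Ω : Type*} {W : ℕ → Matrix (Fin N) (Fin N) ℝ} {σ : ℝ} (hσ : 0 < σ)
    {q₀ : Fin N → ℝ} (ν₀ : Fin N → ℝ) (o : ℕ → Fin N → Ω → ℝ)
    (hW : ∀ t i j, 0 ≤ W t i j) (hq : ∀ i, 0 ≤ q₀ i) (t : ℕ) (i : Fin N) (ω : Ω) :
    aggMean W σ q₀ ν₀ o (t + 1) i ω * aggPrecision W σ q₀ (t + 1) i
      = privateMean o (t + 1) i ω * privatePrecision σ (t + 1)
        + (W t).mulVec (fun j => aggMean W σ q₀ ν₀ o t j ω * aggPrecision W σ q₀ t j) i :=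
  div_mul_cancel₀ _ (aggPrecision_succ_pos hσ hW hq t i).ne'

end

end TrustDynamics

open TrustDynamics

/-!
The largest admissible drift can be taken to be `h = L`.

Write `s t` for the common column sum of `W t`. The all-ones vector is a left eigenvector of `W t`
for the eigenvalue `s t`, and `s t` bounds the modulus of every eigenvalue, so that `s t ≥ c > 1`.

*Drift of the Perron vectors.* A non-negative matrix with column sums `s`, any two of whose columns
share a row where both entries are at least `L`, contracts the 1-norm of zero-sum vectors by the
factor `s - L` (Dobrushin's argument, `vecOneNorm_mulVec_le_of_sum_eq_zero`). If `u` and `v` are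
the normalized Perron vectors of `A` and `B`, with eigenvalues `s` and `s'`, then
`s' (v - u) = B (v - u) + (B - A) u + (s - s') u`, and `v - u` has zero sum; the last two terms
have 1-norm at most `ε` each.

*Lock-in.* If `ε < L`, no entry can change between zero and non-zero, so all the `W t` have the
zero pattern of `W 0` and dominate `(L / U) • W 0` entrywise. Since some power of `W 0` is positive,
the response `g t` of the unnormalized means to the first observation of agent `i` reaches every
agent within a bounded time, and grows at least like `∏ s τ`. The precisions grow at most like
`∏ s τ`, because `∑ t / c ^ t` converges. Hence the weight `g t i / aggPrecision t i` of that single observation in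
the mean of agent `i` stays bounded away from zero (`exists_mul_aggPrecision_le_impulse`). With all
the other observations held fixed, the mean of agent `i` therefore converges to `μ` for at most one
value of that observation, and its Gaussian law has no atoms; integrating over the other
observations gives probability zero.
-/

namespace TrustDynamics

/-! ### One-norms and column sums -/

section Norms

variable {N : ℕ}

theorem sum_abs_le_matrixOneNorm (A : Matrix (Fin N) (Fin N) ℝ) (j : Fin N) :
    ∑ i, |A i j| ≤ matrixOneNorm A :=
  le_ciSup (f := fun j => ∑ i, |A i j|) (Set.finite_range _).bddAbove j

theorem abs_le_matrixOneNorm (A : Matrix (Fin N) (Fin N) ℝ) (i j : Fin N) :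
    |A i j| ≤ matrixOneNorm A :=
  (Finset.single_le_sum (f := fun i => |A i j|) (fun _ _ => abs_nonneg _)
    (Finset.mem_univ i)).trans (sum_abs_le_matrixOneNorm A j)

theorem vecOneNorm_add_le (v w : Fin N → ℝ) :
    vecOneNorm (v + w) ≤ vecOneNorm v + vecOneNorm w := by
  unfold vecOneNorm
  rw [← Finset.sum_add_distrib]
  exact Finset.sum_le_sum fun i _ => abs_add_le _ _

theorem vecOneNorm_smul (a : ℝ) (v : Fin N → ℝ) : vecOneNorm (a • v) = |a| * vecOneNorm v := by
  simp [vecOneNorm, abs_mul, Finset.mul_sum]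

theorem vecOneNorm_mulVec_le {A : Matrix (Fin N) (Fin N) ℝ} {a : ℝ}
    (hA : ∀ j, ∑ i, |A i j| ≤ a) (v : Fin N → ℝ) :
    vecOneNorm (A.mulVec v) ≤ a * vecOneNorm v := by
  calc vecOneNorm (A.mulVec v) ≤ ∑ i, ∑ j, |A i j| * |v j| := by
        refine Finset.sum_le_sum fun i _ => ?_
        simp only [Matrix.mulVec, dotProduct, ← abs_mul]
        exact Finset.abs_sum_le_sum_abs _ _
    _ = ∑ j, (∑ i, |A i j|) * |v j| := by
        rw [Finset.sum_comm]; simp only [Finset.sum_mul]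
    _ ≤ ∑ j, a * |v j| :=
        Finset.sum_le_sum fun j _ => mul_le_mul_of_nonneg_right (hA j) (abs_nonneg _)
    _ = a * vecOneNorm v := by rw [vecOneNorm, Finset.mul_sum]

theorem sum_mulVec_of_sum_col_eq {A : Matrix (Fin N) (Fin N) ℝ} {s : ℝ}
    (hA : ∀ j, ∑ i, A i j = s) (v : Fin N → ℝ) :
    ∑ i, A.mulVec v i = s * ∑ j, v j := by
  simp only [Matrix.mulVec, dotProduct]
  rw [Finset.sum_comm]
  simp only [← Finset.sum_mul, hA, Finset.mul_sum]

/-- The spectral radius of a non-negative matrix is at most the common value of its column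
sums. -/
theorem rho_le_of_sum_col_eq {A : Matrix (Fin N) (Fin N) ℝ} {s : ℝ} (hs : 0 ≤ s)
    (hA0 : ∀ i j, 0 ≤ A i j) (hA : ∀ j, ∑ i, A i j = s) : rho A ≤ s := by
  refine ENNReal.toReal_le_of_le_ofReal hs (iSup₂_le fun z hz => ?_)
  rw [← Matrix.spectrum_toLin', ← Module.End.hasEigenvalue_iff_mem_spectrum] at hz
  obtain ⟨w, hw⟩ := hz.exists_hasEigenvector
  have hAw : (toComplex A).mulVec w = z • w := by
    simpa only [Matrix.toLin'_apply] using hw.apply_eq_smul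
  have hpos : 0 < ∑ j, ‖w j‖ := by
    obtain ⟨j, hj⟩ := Function.ne_iff.1 hw.2
    exact Finset.sum_pos' (fun _ _ => norm_nonneg _) ⟨j, Finset.mem_univ j, norm_pos_iff.2 hj⟩
  have hle : ‖z‖ * ∑ j, ‖w j‖ ≤ s * ∑ j, ‖w j‖ := by
    calc ‖z‖ * ∑ j, ‖w j‖ = ∑ i, ‖(toComplex A).mulVec w i‖ := by
          simp [hAw, Finset.mul_sum]
      _ ≤ ∑ i, ∑ j, A i j * ‖w j‖ := by
          refine Finset.sum_le_sum fun i _ => ?_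
          rw [Matrix.mulVec, dotProduct]
          refine (norm_sum_le _ _).trans (Finset.sum_le_sum fun j _ => ?_)
          simp [toComplex, abs_of_nonneg (hA0 i j)]
      _ = s * ∑ j, ‖w j‖ := by
          rw [Finset.sum_comm]
          simp only [← Finset.sum_mul, hA, Finset.mul_sum]
  have hzs : ‖z‖ ≤ s := le_of_mul_le_mul_right hle hpos
  show ‖z‖ₑ ≤ ENNReal.ofReal s
  rw [← ofReal_norm]
  exact ENNReal.ofReal_le_ofReal hzs

theorem IsPerronVector.rho_eq_of_sum_col_eq {A : Matrix (Fin N) (Fin N) ℝ} {v : Fin N → ℝ}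
    (hv : IsPerronVector A v) {s : ℝ} (hA : ∀ j, ∑ i, A i j = s) (i : Fin N) : rho A = s := by
  have hpos : 0 < ∑ j, v j := Finset.sum_pos (fun j _ => hv.1 j) ⟨i, Finset.mem_univ i⟩
  have h := sum_mulVec_of_sum_col_eq hA v
  rw [hv.2] at h
  simp only [Pi.smul_apply, smul_eq_mul, ← Finset.mul_sum] at h
  exact mul_right_cancel₀ hpos.ne' h

end Norms

/-! ### Dobrushin contraction and the drift of Perron vectors -/

section Perron

variable {N : ℕ}

/-- Two columns overlap in mass at least `L` if some row has both entries at least `L`; the overlap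
cancels in the difference of the columns. -/
theorem sum_abs_sub_col_le {B : Matrix (Fin N) (Fin N) ℝ} {s L : ℝ} (hB0 : ∀ i j, 0 ≤ B i j)
    (hB : ∀ j, ∑ i, B i j = s) {i j k : Fin N} (hi : L ≤ B k i) (hj : L ≤ B k j) :
    ∑ l, |B l i - B l j| ≤ 2 * (s - L) := by
  have h : ∀ l, |B l i - B l j| ≤ B l i + B l j - if l = k then 2 * L else 0 := by
    intro l
    have h1 := hB0 l i
    have h2 := hB0 l j
    split_ifs with hl
    · subst hl
      rw [abs_le]; constructor <;> linarith
    · rw [abs_le]; constructor <;> linarith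
  calc ∑ l, |B l i - B l j| ≤ ∑ l, (B l i + B l j - if l = k then 2 * L else 0) :=
        Finset.sum_le_sum fun l _ => h l
    _ = 2 * (s - L) := by
        rw [Finset.sum_sub_distrib, Finset.sum_add_distrib, hB, hB]
        simp; ring

/-- Dobrushin's contraction estimate: the positive and negative parts of a zero-sum vector have
equal mass, and every pair of columns weighted by them partly cancels. -/
theorem vecOneNorm_mulVec_le_of_sum_eq_zero {B : Matrix (Fin N) (Fin N) ℝ} {s L : ℝ}
    (hB0 : ∀ i j, 0 ≤ B i j) (hB : ∀ j, ∑ i, B i j = s)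
    (hL : ∀ i j, i ≠ j → ∃ k, L ≤ B k i ∧ L ≤ B k j) {z : Fin N → ℝ} (hz : ∑ i, z i = 0) :
    vecOneNorm (B.mulVec z) ≤ (s - L) * vecOneNorm z := by
  set m := ∑ i, (z i)⁺ with hm
  have hmneg : ∑ i, (z i)⁻ = m := by
    have : ∑ i, ((z i)⁺ - (z i)⁻) = 0 := by simpa only [posPart_sub_negPart] using hz
    rw [Finset.sum_sub_distrib] at this
    linarith
  have hnorm : vecOneNorm z = 2 * m := by
    have : vecOneNorm z = ∑ i, ((z i)⁺ + (z i)⁻) := by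
      simp only [posPart_add_negPart]; rfl
    rw [this, Finset.sum_add_distrib, hmneg, ← hm]; ring
  have hm0 : 0 ≤ m := Finset.sum_nonneg fun i _ => posPart_nonneg _
  rcases hm0.eq_or_lt with h0 | hmpos
  · have hz0 : z = 0 := by
      have h1 : ∑ i, |z i| = 0 := by
        have := hnorm
        rw [← h0] at this
        simpa [vecOneNorm] using this
      funext i
      exact abs_eq_zero.1
        ((Finset.sum_eq_zero_iff_of_nonneg fun i _ => abs_nonneg (z i)).1 h1 i (Finset.mem_univ i))
    simp [hz0, vecOneNorm]
  -- `m • B z` is a combination of differences of columns, with weights `(z i)⁺ * (z j)⁻`.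
  have hrep : ∀ k, m * B.mulVec z k = ∑ i, ∑ j, (z i)⁺ * (z j)⁻ * (B k i - B k j) := by
    intro k
    have e1 : B.mulVec z k = ∑ i, B k i * (z i)⁺ - ∑ i, B k i * (z i)⁻ := by
      simp only [← Finset.sum_sub_distrib, ← mul_sub, posPart_sub_negPart]
      rfl
    have e2 : ∑ i, ∑ j, (z i)⁺ * (z j)⁻ * (B k i - B k j)
        = (∑ i, B k i * (z i)⁺) * (∑ j, (z j)⁻) - (∑ i, (z i)⁺) * ∑ j, B k j * (z j)⁻ := by
      rw [Finset.sum_mul_sum, Finset.sum_mul_sum, ← Finset.sum_sub_distrib]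
      refine Finset.sum_congr rfl fun i _ => ?_
      rw [← Finset.sum_sub_distrib]
      exact Finset.sum_congr rfl fun j _ => by ring
    rw [e2, hmneg, ← hm, e1]; ring
  have hw : ∀ i j, 0 ≤ (z i)⁺ * (z j)⁻ := fun i j =>
    mul_nonneg (posPart_nonneg _) (negPart_nonneg _)
  have hkey : m * vecOneNorm (B.mulVec z) ≤ m * ((s - L) * vecOneNorm z) := by
    calc m * vecOneNorm (B.mulVec z) = ∑ k, |m * B.mulVec z k| := by
          simp [vecOneNorm, Finset.mul_sum, abs_mul, abs_of_nonneg hm0]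
      _ ≤ ∑ k, ∑ i, ∑ j, (z i)⁺ * (z j)⁻ * |B k i - B k j| := by
          refine Finset.sum_le_sum fun k _ => ?_
          rw [hrep]
          refine (Finset.abs_sum_le_sum_abs _ _).trans (Finset.sum_le_sum fun i _ =>
            (Finset.abs_sum_le_sum_abs _ _).trans (Finset.sum_le_sum fun j _ => ?_))
          rw [abs_mul, abs_of_nonneg (hw i j)]
      _ = ∑ i, ∑ j, (z i)⁺ * (z j)⁻ * ∑ k, |B k i - B k j| := by
          rw [Finset.sum_comm]
          refine Finset.sum_congr rfl fun i _ => ?_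
          rw [Finset.sum_comm]
          simp only [Finset.mul_sum]
      _ ≤ ∑ i, ∑ j, (z i)⁺ * (z j)⁻ * (2 * (s - L)) := by
          refine Finset.sum_le_sum fun i _ => Finset.sum_le_sum fun j _ => ?_
          by_cases hij : i = j
          · subst hij
            have : (z i)⁺ * (z i)⁻ = 0 := by
              rcases le_total (z i) 0 with h | h
              · rw [posPart_eq_zero.2 h, zero_mul]
              · rw [negPart_eq_zero.2 h, mul_zero]
            rw [this, zero_mul, zero_mul]
          · obtain ⟨k, hi, hj⟩ := hL i j hij
            exact mul_le_mul_of_nonneg_left (sum_abs_sub_col_le hB0 hB hi hj) (hw i j)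
      _ = m * ((s - L) * vecOneNorm z) := by
          simp only [← Finset.sum_mul, ← Finset.mul_sum, hmneg, ← hm, hnorm]; ring
  exact le_of_mul_le_mul_left hkey hmpos

theorem vecOneNorm_of_pos {v : Fin N → ℝ} (hv : ∀ i, 0 < v i) : vecOneNorm v = ∑ i, v i :=
  Finset.sum_congr rfl fun i _ => abs_of_pos (hv i)

theorem IsPerronVector.sum_normalized {A : Matrix (Fin N) (Fin N) ℝ} {v : Fin N → ℝ}
    (hv : IsPerronVector A v) (i : Fin N) : ∑ j, normalized v j = 1 := by
  have hpos : 0 < ∑ j, v j := Finset.sum_pos (fun j _ => hv.1 j) ⟨i, Finset.mem_univ i⟩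
  simp only [normalized, vecOneNorm_of_pos hv.1, ← Finset.sum_div]
  exact div_self hpos.ne'

theorem IsPerronVector.normalized {A : Matrix (Fin N) (Fin N) ℝ} {v : Fin N → ℝ}
    (hv : IsPerronVector A v) (i : Fin N) : IsPerronVector A (normalized v) := by
  have hpos : 0 < vecOneNorm v := by
    rw [vecOneNorm_of_pos hv.1]
    exact Finset.sum_pos (fun j _ => hv.1 j) ⟨i, Finset.mem_univ i⟩
  have h : TrustDynamics.normalized v = (vecOneNorm v)⁻¹ • v := by
    funext j
    simp [TrustDynamics.normalized, div_eq_inv_mul]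
  refine ⟨fun j => div_pos (hv.1 j) hpos, ?_⟩
  rw [h, Matrix.mulVec_smul, hv.2, smul_comm]

/-- The normalized Perron vector depends on the matrix in a Lipschitz way, with constant `2 / L`,
among non-negative matrices with constant column sums. -/
theorem vecOneNorm_normalized_sub_le {A B : Matrix (Fin N) (Fin N) ℝ} {ε L : ℝ} (hL : 0 < L)
    (hε : 0 ≤ ε) (hAB : matrixOneNorm (B - A) ≤ ε) (hB0 : ∀ i j, 0 ≤ B i j)
    (hA : EqualIncomingTrust A) (hB : EqualIncomingTrust B)
    (hBL : ∀ i j, i ≠ j → ∃ k, L ≤ B k i ∧ L ≤ B k j) {u v : Fin N → ℝ}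
    (hu : IsPerronVector A u) (hv : IsPerronVector B v) :
    vecOneNorm (normalized v - normalized u) ≤ 2 * ε / L := by
  rcases isEmpty_or_nonempty (Fin N) with hN | ⟨⟨i₀⟩⟩
  · simp only [vecOneNorm, Finset.univ_eq_empty, Finset.sum_empty]
    positivity
  obtain ⟨s, hs⟩ := hA
  obtain ⟨s', hs'⟩ := hB
  have hu' := hu.normalized i₀
  have hv' := hv.normalized i₀
  have hu1 := hu.sum_normalized i₀
  have hv1 := hv.sum_normalized i₀
  have hunorm : vecOneNorm (normalized u) = 1 := by rw [vecOneNorm_of_pos hu'.1, hu1]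
  have hAu := hu'.2
  have hBv := hv'.2
  rw [hu.rho_eq_of_sum_col_eq hs i₀] at hAu
  rw [hv.rho_eq_of_sum_col_eq hs' i₀] at hBv
  have hss : |s - s'| ≤ ε := by
    rw [abs_sub_comm, ← hs i₀, ← hs' i₀, ← Finset.sum_sub_distrib]
    exact (Finset.abs_sum_le_sum_abs _ _).trans ((sum_abs_le_matrixOneNorm (B - A) i₀).trans hAB)
  have hs'0 : 0 ≤ s' := hs' i₀ ▸ Finset.sum_nonneg fun i _ => hB0 i i₀
  set x := normalized u
  set y := normalized v
  have hzero : ∑ i, (y - x) i = 0 := by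
    simp only [Pi.sub_apply, Finset.sum_sub_distrib, hu1, hv1, sub_self]
  have hid : s' • (y - x) = B.mulVec (y - x) + ((B - A).mulVec x + (s - s') • x) := by
    rw [Matrix.mulVec_sub, Matrix.sub_mulVec, hAu, hBv, smul_sub, sub_smul]; abel
  have h1 : s' * vecOneNorm (y - x) ≤ (s' - L) * vecOneNorm (y - x) + (ε * 1 + ε * 1) := by
    calc s' * vecOneNorm (y - x) = vecOneNorm (s' • (y - x)) := by
          rw [vecOneNorm_smul, abs_of_nonneg hs'0]
      _ ≤ vecOneNorm (B.mulVec (y - x))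
            + (vecOneNorm ((B - A).mulVec x) + vecOneNorm ((s - s') • x)) := by
          rw [hid]
          exact (vecOneNorm_add_le _ _).trans (add_le_add le_rfl (vecOneNorm_add_le _ _))
      _ ≤ _ := by
          refine add_le_add (vecOneNorm_mulVec_le_of_sum_eq_zero hB0 hs' hBL hzero)
            (add_le_add ?_ ?_)
          · rw [← hunorm]
            exact vecOneNorm_mulVec_le
              (fun j => (sum_abs_le_matrixOneNorm (B - A) j).trans hAB) _
          · rw [vecOneNorm_smul, hunorm]
            exact mul_le_mul_of_nonneg_right hss zero_le_one
  rw [le_div_iff₀ hL]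
  linarith

end Perron

/-! ### Response to a single observation -/

section Impulse

variable {N : ℕ}

/-- The response of the unnormalized aggregate means to a unit increase of `σ⁻²` times the first
observation of agent `i₀`; that observation enters every later private mean of agent `i₀`. -/
def impulse (W : ℕ → Matrix (Fin N) (Fin N) ℝ) (i₀ : Fin N) : ℕ → Fin N → ℝ
  | 0 => 0
  | t + 1 => fun i => (if i = i₀ then 1 else 0) + (W t).mulVec (impulse W i₀ t) i

theorem impulse_nonneg {W : ℕ → Matrix (Fin N) (Fin N) ℝ} (hW : ∀ t i j, 0 ≤ W t i j)
    (i₀ : Fin N) (t : ℕ) (i : Fin N) : 0 ≤ impulse W i₀ t i := by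
  induction t generalizing i with
  | zero => exact le_rfl
  | succ t ih =>
    have h : 0 ≤ (W t).mulVec (impulse W i₀ t) i := by
      rw [Matrix.mulVec, dotProduct]
      exact Finset.sum_nonneg fun j _ => mul_nonneg (hW t i j) (ih j)
    exact add_nonneg (by split_ifs <;> norm_num) h

/-- A sequence driven by matrices that dominate `r • A` dominates the powers of `r • A`. -/
theorem pow_mulVec_le_of_forall_mulVec_le {W : ℕ → Matrix (Fin N) (Fin N) ℝ}
    {A : Matrix (Fin N) (Fin N) ℝ} {r : ℝ} (hr : 0 ≤ r) (hA : ∀ i j, 0 ≤ A i j)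
    (hWA : ∀ t i j, r * A i j ≤ W t i j) {x : ℕ → Fin N → ℝ} (hx0 : ∀ t i, 0 ≤ x t i)
    (hx : ∀ t i, (W t).mulVec (x t) i ≤ x (t + 1) i) (t k : ℕ) (i : Fin N) :
    r ^ k * (A ^ k).mulVec (x t) i ≤ x (t + k) i := by
  induction k generalizing i with
  | zero => simp
  | succ k ih =>
    calc r ^ (k + 1) * (A ^ (k + 1)).mulVec (x t) i
        = ∑ j, r * A i j * (r ^ k * (A ^ k).mulVec (x t) j) := by
          rw [pow_succ' A, ← Matrix.mulVec_mulVec, Matrix.mulVec, dotProduct, Finset.mul_sum]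
          exact Finset.sum_congr rfl fun j _ => by ring
      _ ≤ ∑ j, W (t + k) i j * x (t + k) j := by
          refine Finset.sum_le_sum fun j _ => ?_
          have h1 : r * A i j * (r ^ k * (A ^ k).mulVec (x t) j) ≤ r * A i j * x (t + k) j :=
            mul_le_mul_of_nonneg_left (ih j) (mul_nonneg hr (hA i j))
          exact h1.trans (mul_le_mul_of_nonneg_right (hWA _ _ _) (hx0 _ _))
      _ ≤ x (t + (k + 1)) i := hx (t + k) i

theorem sum_impulse_succ {W : ℕ → Matrix (Fin N) (Fin N) ℝ} {s : ℕ → ℝ}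
    (hs : ∀ t j, ∑ i, W t i j = s t) (i₀ : Fin N) (t : ℕ) :
    ∑ i, impulse W i₀ (t + 1) i = 1 + s t * ∑ i, impulse W i₀ t i := by
  rw [← sum_mulVec_of_sum_col_eq (hs t)]
  simp [impulse, Finset.sum_add_distrib]

theorem prod_range_le_mul_sum_impulse {W : ℕ → Matrix (Fin N) (Fin N) ℝ} {s : ℕ → ℝ}
    (hs0 : ∀ t, 0 ≤ s t) (hs : ∀ t j, ∑ i, W t i j = s t) (i₀ : Fin N) (t : ℕ) :
    ∏ τ ∈ Finset.range (t + 1), s τ ≤ s 0 * ∑ i, impulse W i₀ (t + 1) i := by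
  induction t with
  | zero =>
    rw [sum_impulse_succ hs]
    simp [impulse]
  | succ t ih =>
    rw [sum_impulse_succ hs, Finset.prod_range_succ]
    have := mul_le_mul_of_nonneg_right ih (hs0 (t + 1))
    linarith [hs0 0]

/-- The total precision grows at most like the product of the column sums. -/
theorem exists_sum_aggPrecision_le {W : ℕ → Matrix (Fin N) (Fin N) ℝ} {s : ℕ → ℝ} {c : ℝ}
    (hc : 1 < c) (hsc : ∀ t, c ≤ s t) (hs : ∀ t j, ∑ i, W t i j = s t) (σ : ℝ)
    {q₀ : Fin N → ℝ} (hq : ∀ i, 0 ≤ q₀ i) :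
    ∃ C > 0, ∀ t, ∑ i, aggPrecision W σ q₀ t i ≤ C * ∏ τ ∈ Finset.range t, s τ := by
  have hc0 : 0 < c := one_pos.trans hc
  have hsum : Summable fun n : ℕ => (n : ℝ) * c⁻¹ ^ n := by
    simpa using summable_pow_mul_geometric_of_norm_lt_one 1
      (r := c⁻¹) (by rw [norm_inv, Real.norm_of_nonneg hc0.le]; exact inv_lt_one_of_one_lt₀ hc)
  have hS : ∀ t, c ^ t ≤ ∏ τ ∈ Finset.range t, s τ := fun t => by
    simpa using Finset.prod_le_prod (s := Finset.range t) (f := fun _ => c) (g := s)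
      (fun _ _ => hc0.le) fun τ _ => hsc τ
  have hS0 : ∀ t, 0 < ∏ τ ∈ Finset.range t, s τ := fun t => (pow_pos hc0 t).trans_le (hS t)
  set K : ℝ := N * (σ ^ 2)⁻¹ with hK
  have hK0 : 0 ≤ K := by positivity
  have hterm : ∀ n : ℕ, 0 ≤ (n : ℝ) * c⁻¹ ^ n := fun n => by positivity
  have main : ∀ t, ∑ i, aggPrecision W σ q₀ t i
      ≤ (∑ i, q₀ i + K * ∑ n ∈ Finset.range (t + 1), (n : ℝ) * c⁻¹ ^ n)
        * ∏ τ ∈ Finset.range t, s τ := by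
    intro t
    induction t with
    | zero => simp [aggPrecision]
    | succ t ih =>
      have e : ∑ i, aggPrecision W σ q₀ (t + 1) i
          = K * ((t + 1 : ℕ) : ℝ) + s t * ∑ i, aggPrecision W σ q₀ t i := by
        rw [← sum_mulVec_of_sum_col_eq (hs t)]
        simp only [aggPrecision_succ, Finset.sum_add_distrib, Finset.sum_const, Finset.card_univ,
          Fintype.card_fin, nsmul_eq_mul, privatePrecision, hK]
        ring
      have h1 : ((t + 1 : ℕ) : ℝ) ≤ ((t + 1 : ℕ) : ℝ) * c⁻¹ ^ (t + 1)
          * ∏ τ ∈ Finset.range (t + 1), s τ := by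
        rw [mul_assoc]
        refine le_mul_of_one_le_right (Nat.cast_nonneg _) ?_
        rw [inv_pow, ← div_eq_inv_mul, one_le_div (pow_pos hc0 _)]
        exact hS _
      have h2 := mul_le_mul_of_nonneg_left h1 hK0
      have h3 := mul_le_mul_of_nonneg_left ih (hc0.le.trans (hsc t))
      rw [e, Finset.sum_range_succ _ (t + 1)]
      rw [Finset.prod_range_succ] at h2 ⊢
      linarith
  have hT : ∀ t, ∑ n ∈ Finset.range (t + 1), (n : ℝ) * c⁻¹ ^ n ≤ ∑' n : ℕ, (n : ℝ) * c⁻¹ ^ n :=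
    fun t => hsum.sum_le_tsum _ fun n _ => hterm n
  refine ⟨∑ i, q₀ i + K * ∑' n : ℕ, (n : ℝ) * c⁻¹ ^ n + 1, ?_, fun t => ?_⟩
  · have h1 : 0 ≤ ∑ i, q₀ i := Finset.sum_nonneg fun i _ => hq i
    have h2 : 0 ≤ K * ∑' n : ℕ, (n : ℝ) * c⁻¹ ^ n := mul_nonneg hK0 (tsum_nonneg hterm)
    linarith
  · refine (main t).trans (mul_le_mul_of_nonneg_right ?_ (hS0 t).le)
    linarith [mul_le_mul_of_nonneg_left (hT t) hK0]

/-- The first observation of an agent keeps a weight bounded away from zero in the mean of every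
agent. -/
theorem exists_mul_aggPrecision_le_impulse {W : ℕ → Matrix (Fin N) (Fin N) ℝ} {s : ℕ → ℝ}
    {c r B : ℝ} (hc : 1 < c) (hr : 0 < r) (hW0 : (W 0).IsPrimitive)
    (hW : ∀ t i j, 0 ≤ W t i j) (hWr : ∀ t i j, r * W 0 i j ≤ W t i j) (hsc : ∀ t, c ≤ s t)
    (hsB : ∀ t, s t ≤ B) (hs : ∀ t j, ∑ i, W t i j = s t) (σ : ℝ) {q₀ : Fin N → ℝ}
    (hq : ∀ i, 0 ≤ q₀ i) (i₀ : Fin N) :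
    ∃ κ > 0, ∃ T, ∀ t ≥ T, ∀ i, κ * aggPrecision W σ q₀ t i ≤ impulse W i₀ t i := by
  obtain ⟨C, hC, hQ⟩ := exists_sum_aggPrecision_le hc hsc hs σ hq
  obtain ⟨k, -, hk⟩ := hW0.exists_pos_pow
  have hs0 : ∀ t, 0 < s t := fun t => one_pos.trans (hc.trans_le (hsc t))
  have hB : 0 < B := (hs0 0).trans_le (hsB 0)
  obtain ⟨m, hm, hkm⟩ : ∃ m > 0, ∀ i j, m ≤ (W 0 ^ k) i j := by
    have : Nonempty (Fin N) := ⟨i₀⟩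
    obtain ⟨p, hp⟩ := Finite.exists_min fun p : Fin N × Fin N => (W 0 ^ k) p.1 p.2
    exact ⟨_, hk p.1 p.2, fun i j => hp (i, j)⟩
  have hg0 := impulse_nonneg hW i₀
  have hgrow : ∀ t i, (W t).mulVec (impulse W i₀ t) i ≤ impulse W i₀ (t + 1) i := fun t i =>
    le_add_of_nonneg_left (by split_ifs <;> norm_num)
  -- Within `k` steps, every agent receives a fixed share of the total response.
  have hlow : ∀ t i, r ^ k * m * ∑ j, impulse W i₀ t j ≤ impulse W i₀ (t + k) i := by
    intro t i
    refine le_trans ?_ (pow_mulVec_le_of_forall_mulVec_le hr.le hW0.nonneg hWr hg0 hgrow t k i)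
    rw [mul_assoc, Finset.mul_sum]
    exact mul_le_mul_of_nonneg_left (Finset.sum_le_sum fun j _ =>
      mul_le_mul_of_nonneg_right (hkm i j) (hg0 t j)) (pow_pos hr k).le
  -- The delay of `k` steps costs only a constant factor in the growth of the precisions.
  have hup : ∀ t, ∏ τ ∈ Finset.range (t + k), s τ ≤ (∏ τ ∈ Finset.range t, s τ) * B ^ k := by
    intro t
    rw [Finset.prod_range_add]
    refine mul_le_mul_of_nonneg_left ?_ (Finset.prod_nonneg fun τ _ => (hs0 τ).le)
    simpa using Finset.prod_le_prod (s := Finset.range k) (fun τ _ => (hs0 (t + τ)).le)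
      fun τ _ => hsB (t + τ)
  have hD : 0 < C * B ^ k * s 0 := mul_pos (mul_pos hC (pow_pos hB k)) (hs0 0)
  refine ⟨r ^ k * m / (C * B ^ k * s 0), div_pos (mul_pos (pow_pos hr k) hm) hD, 1 + k,
    fun n hn i => ?_⟩
  obtain ⟨t, rfl⟩ : ∃ t, n = t + 1 + k := ⟨n - 1 - k, by omega⟩
  have hq1 : aggPrecision W σ q₀ (t + 1 + k) i
      ≤ C * B ^ k * s 0 * ∑ j, impulse W i₀ (t + 1) j := by
    calc aggPrecision W σ q₀ (t + 1 + k) i ≤ ∑ j, aggPrecision W σ q₀ (t + 1 + k) j :=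
          Finset.single_le_sum (f := fun j => aggPrecision W σ q₀ (t + 1 + k) j)
            (fun j _ => aggPrecision_nonneg σ hW hq _ j) (Finset.mem_univ i)
      _ ≤ C * ∏ τ ∈ Finset.range (t + 1 + k), s τ := hQ _
      _ ≤ C * ((s 0 * ∑ j, impulse W i₀ (t + 1) j) * B ^ k) :=
          mul_le_mul_of_nonneg_left ((hup (t + 1)).trans (mul_le_mul_of_nonneg_right
            (prod_range_le_mul_sum_impulse (fun t => (hs0 t).le) hs i₀ t) (pow_pos hB k).le)) hC.le
      _ = _ := by ring
  refine le_trans ?_ (hlow (t + 1) i)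
  rw [div_mul_eq_mul_div, div_le_iff₀ hD]
  have := mul_le_mul_of_nonneg_left hq1 (mul_pos (pow_pos hr k) hm).le
  linarith

end Impulse

/-! ### Dependence of the aggregate means on one observation -/

section Dependence

variable {N : ℕ} {Ω Ω' : Type*}

theorem privateMean_mul_privatePrecision (o : ℕ → Fin N → Ω → ℝ) (σ : ℝ) (t : ℕ) (i : Fin N)
    (ω : Ω) :
    privateMean o t i ω * privatePrecision σ t = (σ ^ 2)⁻¹ * ∑ s ∈ Finset.range t, o s i ω := by
  induction t with
  | zero => simp [privatePrecision]
  | succ t ih => rw [privateMean_succ, ih, Finset.sum_range_succ, mul_add]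

/-- The aggregate means depend on the sample point through the observations only. -/
theorem aggMean_congr (W : ℕ → Matrix (Fin N) (Fin N) ℝ) (σ : ℝ) (q₀ ν₀ : Fin N → ℝ)
    {o : ℕ → Fin N → Ω → ℝ} {o' : ℕ → Fin N → Ω' → ℝ} {ω : Ω} {ω' : Ω'}
    (h : ∀ s i, o s i ω = o' s i ω') (t : ℕ) (i : Fin N) :
    aggMean W σ q₀ ν₀ o t i ω = aggMean W σ q₀ ν₀ o' t i ω' := by
  induction t generalizing i with
  | zero => rfl
  | succ t ih => simp only [aggMean, privateMean, h, ih]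

theorem measurable_aggMean [MeasurableSpace Ω] (W : ℕ → Matrix (Fin N) (Fin N) ℝ) (σ : ℝ)
    (q₀ ν₀ : Fin N → ℝ) {o : ℕ → Fin N → Ω → ℝ} (ho : ∀ s i, Measurable (o s i)) (t : ℕ)
    (i : Fin N) : Measurable (aggMean W σ q₀ ν₀ o t i) := by
  induction t generalizing i with
  | zero => exact measurable_const
  | succ t ih =>
    unfold aggMean privateMean
    fun_prop

/-- Changing only the first observation of agent `i₀` shifts the aggregate means by multiples of
the impulse response. -/
theorem aggMean_sub_mul_aggPrecision {W : ℕ → Matrix (Fin N) (Fin N) ℝ} {σ : ℝ} (hσ : 0 < σ)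
    {q₀ : Fin N → ℝ} (ν₀ : Fin N → ℝ) (hW : ∀ t i j, 0 ≤ W t i j) (hq : ∀ i, 0 ≤ q₀ i)
    {o : ℕ → Fin N → Ω → ℝ} {ω ω' : Ω} {i₀ : Fin N} {d : ℝ}
    (h0 : ∀ s i, o s i ω' = o s i ω + if s = 0 ∧ i = i₀ then d else 0) (t : ℕ) (i : Fin N) :
    (aggMean W σ q₀ ν₀ o t i ω' - aggMean W σ q₀ ν₀ o t i ω) * aggPrecision W σ q₀ t i
      = d * (σ ^ 2)⁻¹ * impulse W i₀ t i := by
  induction t generalizing i with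
  | zero => simp [aggMean, impulse]
  | succ t ih =>
    have hsum : ∑ s ∈ Finset.range (t + 1), o s i ω'
        = ∑ s ∈ Finset.range (t + 1), o s i ω + if i = i₀ then d else 0 := by
      simp only [h0, Finset.sum_add_distrib, add_right_inj]
      by_cases hi : i = i₀ <;> simp [hi]
    have hlin : (W t).mulVec (fun j => aggMean W σ q₀ ν₀ o t j ω' * aggPrecision W σ q₀ t j) i
        = (W t).mulVec (fun j => aggMean W σ q₀ ν₀ o t j ω * aggPrecision W σ q₀ t j) i
          + d * (σ ^ 2)⁻¹ * (W t).mulVec (impulse W i₀ t) i := by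
      simp only [Matrix.mulVec, dotProduct, Finset.mul_sum, ← Finset.sum_add_distrib]
      refine Finset.sum_congr rfl fun j _ => ?_
      linear_combination W t i j * ih j
    rw [sub_mul, aggMean_succ hσ ν₀ o hW hq, aggMean_succ hσ ν₀ o hW hq,
      privateMean_mul_privatePrecision, privateMean_mul_privatePrecision, hsum, hlin]
    simp only [impulse]
    split_ifs <;> ring

end Dependence

/-! ### Null events for product measures -/

section Resampling

variable {ι : Type*} [DecidableEq ι] {X : ι → Type*} [∀ i, MeasurableSpace (X i)]

theorem measurable_update_prod (p : ι) :
    Measurable fun z : X p × (∀ i, X i) => Function.update z.2 p z.1 := by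
  refine measurable_pi_lambda _ fun i => ?_
  by_cases hi : i = p
  · subst hi; simpa using measurable_fst
  · simp only [Function.update_of_ne hi]
    exact (measurable_pi_apply i).comp measurable_snd

/-- Redrawing one coordinate independently leaves a product measure unchanged. -/
theorem map_update_prod_infinitePi (ν : ∀ i, Measure (X i)) [∀ i, IsProbabilityMeasure (ν i)]
    (p : ι) :
    ((ν p).prod (Measure.infinitePi ν)).map (fun z => Function.update z.2 p z.1)
      = Measure.infinitePi ν := by
  refine Measure.eq_infinitePi _ fun s t ht => ?_
  rw [Measure.map_apply (measurable_update_prod p)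
    (MeasurableSet.pi s.countable_toSet fun i _ => ht i)]
  have hpre : (fun z : X p × (∀ i, X i) => Function.update z.2 p z.1) ⁻¹' (s : Set ι).pi t
      = {a | p ∈ s → a ∈ t p} ×ˢ ((s.erase p : Finset ι) : Set ι).pi t := by
    ext ⟨a, x⟩
    simp only [Set.mem_preimage, Set.mem_pi, Set.mem_prod, Set.mem_ofPred_eq, Finset.mem_coe,
      Finset.mem_erase]
    constructor
    · refine fun h => ⟨fun hp => by simpa using h p hp, fun i hi => ?_⟩
      simpa [Function.update_of_ne hi.1] using h i hi.2
    · rintro ⟨h1, h2⟩ i hi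
      by_cases hip : i = p
      · subst hip; simpa using h1 hi
      · simpa [Function.update_of_ne hip] using h2 i ⟨hip, hi⟩
  rw [hpre, Measure.prod_prod, Measure.infinitePi_pi _ fun i _ => ht i]
  by_cases hp : p ∈ s
  · simp only [hp, forall_const, Set.ofPred_mem_eq]
    exact Finset.mul_prod_erase s (fun i => ν i (t i)) hp
  · simp [hp]

/-- An event that, given all other coordinates, contains at most one value of an atomless
coordinate is null. -/
theorem infinitePi_eq_zero_of_subsingleton_section (ν : ∀ i, Measure (X i))
    [∀ i, IsProbabilityMeasure (ν i)] (p : ι) [NullSingletonClass (ν p)] {E : Set (∀ i, X i)}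
    (hE : MeasurableSet E)
    (hsub : ∀ x : ∀ i, X i, {a | Function.update x p a ∈ E}.Subsingleton) :
    Measure.infinitePi ν E = 0 := by
  rw [← map_update_prod_infinitePi ν p, Measure.map_apply (measurable_update_prod p) hE,
    Measure.prod_apply_symm (measurable_update_prod p hE)]
  exact lintegral_eq_zero_of_ae_eq_zero (.of_forall fun x => (hsub x).measure_zero (ν p))

end Resampling

/-! ### Lock-in -/

section LockIn

variable {N : ℕ}

/-- If the drift is smaller than the least non-zero entry, the zero pattern never changes, and the
trust matrices stay comparable to the initial one. -/
theorem SlowPrimitiveTrust.mul_zero_le {W : ℕ → Matrix (Fin N) (Fin N) ℝ} {ε c L U δ : ℝ}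
    (h : SlowPrimitiveTrust W ε c L U δ) (hL : 0 < L) (hLU : L < U) (hε : ε < L) (t : ℕ)
    (i j : Fin N) : L / U * W 0 i j ≤ W t i j := by
  have hstep : ∀ t, W t i j ≠ 0 → W (t + 1) i j ≠ 0 := by
    intro t h1 h2
    have h3 := (abs_le_matrixOneNorm (W (t + 1) - W t) i j).trans (h.drift t)
    rw [Matrix.sub_apply, h2, zero_sub, abs_neg] at h3
    linarith [(h.entries t i j h1).1, le_abs_self (W t i j)]
  have hU : 0 < U := hL.trans hLU
  by_cases h0 : W 0 i j = 0
  · rw [h0, mul_zero]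
    exact (h.primitive t).nonneg i j
  · have ht : W t i j ≠ 0 := by
      induction t with
      | zero => exact h0
      | succ t ih => exact hstep t ih
    refine le_trans ?_ (h.entries t i j ht).1
    rw [div_mul_eq_mul_div, div_le_iff₀ hU]
    exact mul_le_mul_of_nonneg_left (h.entries 0 i j h0).2 hL.le

/-- With all other observations fixed, the mean of agent `i` converges to `μ` for at most one value
of the first observation of agent `i`. -/
theorem eq_zero_of_tendsto_aggMean {Ω : Type*} {W : ℕ → Matrix (Fin N) (Fin N) ℝ} {σ κ d μ : ℝ}
    (hσ : 0 < σ) {q₀ : Fin N → ℝ} (ν₀ : Fin N → ℝ) (hW : ∀ t i j, 0 ≤ W t i j)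
    (hq : ∀ i, 0 ≤ q₀ i) {i : Fin N} (hκ : 0 < κ) {T : ℕ}
    (hg : ∀ t ≥ T, κ * aggPrecision W σ q₀ t i ≤ impulse W i t i)
    {o : ℕ → Fin N → Ω → ℝ} {ω ω' : Ω}
    (h0 : ∀ s j, o s j ω' = o s j ω + if s = 0 ∧ j = i then d else 0)
    (h1 : Tendsto (fun t => aggMean W σ q₀ ν₀ o t i ω) atTop (𝓝 μ))
    (h2 : Tendsto (fun t => aggMean W σ q₀ ν₀ o t i ω') atTop (𝓝 μ)) : d = 0 := by
  have hlim := (h2.sub h1).abs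
  rw [sub_self, abs_zero] at hlim
  have hbound : ∀ᶠ t in atTop, |d| * (σ ^ 2)⁻¹ * κ
      ≤ |aggMean W σ q₀ ν₀ o t i ω' - aggMean W σ q₀ ν₀ o t i ω| := by
    filter_upwards [eventually_ge_atTop (T + 1)] with n hn
    obtain ⟨t, rfl⟩ : ∃ t, n = t + 1 := ⟨n - 1, by omega⟩
    have hqpos := aggPrecision_succ_pos hσ hW hq t i
    -- Precisions are positive from time `1` on, so the division defining the means is genuine.
    refine le_of_mul_le_mul_right ?_ hqpos
    have e := congrArg abs (aggMean_sub_mul_aggPrecision hσ ν₀ hW hq h0 (t + 1) i)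
    rw [abs_mul, abs_of_pos hqpos, abs_mul, abs_mul, abs_of_nonneg (impulse_nonneg hW i _ i),
      abs_of_nonneg (by positivity : (0 : ℝ) ≤ (σ ^ 2)⁻¹)] at e
    rw [e, mul_assoc]
    exact mul_le_mul_of_nonneg_left (hg (t + 1) (by omega)) (by positivity)
  have h3 := ge_of_tendsto hlim hbound
  have h4 : 0 < (σ ^ 2)⁻¹ * κ := by positivity
  rw [mul_assoc] at h3
  have h5 : |d| ≤ 0 := nonpos_of_mul_nonpos_left h3 h4
  exact abs_nonpos_iff.1 h5

/-- The lock-in property of an agent whose first observation keeps its weight. The weight bound is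
used to show that the event meets every line parallel to that observation in at most one point. -/
theorem measure_tendsto_aggMean_eq_zero {Ω : Type*} [MeasurableSpace Ω] {P : Measure Ω}
    [IsProbabilityMeasure P] {W : ℕ → Matrix (Fin N) (Fin N) ℝ} {σ κ μ : ℝ} (hσ : 0 < σ)
    {q₀ : Fin N → ℝ} (ν₀ : Fin N → ℝ) (hW : ∀ t i j, 0 ≤ W t i j) (hq : ∀ i, 0 ≤ q₀ i)
    {i : Fin N} (hκ : 0 < κ) {T : ℕ}
    (hg : ∀ t ≥ T, κ * aggPrecision W σ q₀ t i ≤ impulse W i t i) {o : ℕ → Fin N → Ω → ℝ}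
    (ho : ∀ t i, HasLaw (o t i) (gaussianReal μ (Real.toNNReal (σ ^ 2))) P)
    (hind : iIndepFun (fun p : ℕ × Fin N => o p.1 p.2) P) :
    P {ω | Tendsto (fun t => aggMean W σ q₀ ν₀ o t i ω) atTop (𝓝 μ)} = 0 := by
  -- The event is the preimage, under the family of all observations, of an event `E` about
  -- the canonical observations on the product space.
  let coord : ℕ → Fin N → (ℕ × Fin N → ℝ) → ℝ := fun s j x => x (s, j)
  have hmeas : ∀ t, Measurable (aggMean W σ q₀ ν₀ coord t i) := fun t =>
    measurable_aggMean W σ q₀ ν₀ (fun s j => measurable_pi_apply (s, j)) t i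
  let E : Set (ℕ × Fin N → ℝ) :=
    {x | Tendsto (fun t => aggMean W σ q₀ ν₀ coord t i x) atTop (𝓝 μ)}
  have hE : MeasurableSet E := measurableSet_tendsto (𝓝 μ) hmeas
  have hX : AEMeasurable (fun ω (p : ℕ × Fin N) => o p.1 p.2 ω) P :=
    aemeasurable_pi_iff.2 fun p => (ho p.1 p.2).aemeasurable
  have hlaw := hind.hasLaw_infinitePi (fun p : ℕ × Fin N => ho p.1 p.2) hX
  have hset : {ω | Tendsto (fun t => aggMean W σ q₀ ν₀ o t i ω) atTop (𝓝 μ)}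
      = (fun ω (p : ℕ × Fin N) => o p.1 p.2 ω) ⁻¹' E := by
    ext ω
    have : ∀ t, aggMean W σ q₀ ν₀ o t i ω
        = aggMean W σ q₀ ν₀ coord t i (fun p => o p.1 p.2 ω) := fun t =>
      aggMean_congr W σ q₀ ν₀ (o := o) (o' := coord) (fun _ _ => rfl) t i
    simp only [Set.mem_ofPred_eq, Set.mem_preimage, E, this]
  have hv : Real.toNNReal (σ ^ 2) ≠ 0 := by
    rw [Ne, Real.toNNReal_eq_zero, not_le]; positivity
  have : NullSingletonClass (gaussianReal μ (Real.toNNReal (σ ^ 2))) :=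
    nullSingletonClass_gaussianReal hv
  rw [hset, ← Measure.map_apply_of_aemeasurable hX hE, hlaw.map_eq]
  refine infinitePi_eq_zero_of_subsingleton_section _ (0, i) hE fun x a ha b hb => ?_
  refine (sub_eq_zero.1 (eq_zero_of_tendsto_aggMean (d := b - a) hσ ν₀ hW hq hκ hg
    (fun s j => ?_) ha hb)).symm
  by_cases hsj : s = 0 ∧ j = i
  · obtain ⟨rfl, rfl⟩ := hsj
    simp [coord]
  · simp [coord, hsj]

end LockIn

end TrustDynamics

theorem mainTheorem4 :
    ∃ h : ℝ → ℝ → ℝ → ℕ → ℝ → ℝ,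
      (∀ c L U N δ, 0 < h c L U N δ) ∧
      ∀ (N : ℕ) (W : ℕ → Matrix (Fin N) (Fin N) ℝ) (ε c L U δ : ℝ),
        0 < ε → 1 < c → 0 < L → L < U → 0 < δ →
        SlowPrimitiveTrust W ε c L U δ →
        (∀ t, EqualIncomingTrust (W t)) →
        (∀ t, CommonTruster (W t)) →
        -- drift of the normalized Perron vectors
        (∀ (t : ℕ) (u v : Fin N → ℝ), IsPerronVector (W t) u → IsPerronVector (W (t + 1)) v →
          vecOneNorm (normalized v - normalized u) ≤ 2 * ε / L) ∧
        -- lock-in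
        (ε < h c L U N δ →
          ∀ (Ω : Type*) [MeasurableSpace Ω] (P : Measure Ω) [IsProbabilityMeasure P]
            (μ σ : ℝ) (o : ℕ → Fin N → Ω → ℝ) (q₀ ν₀ : Fin N → ℝ),
            0 < σ →
            (∀ t i, HasLaw (o t i) (gaussianReal μ (Real.toNNReal (σ ^ 2))) P) →
            iIndepFun (fun p : ℕ × Fin N => o p.1 p.2) P →
            (∀ i, 0 ≤ q₀ i) →
            ∀ i, P {ω | Tendsto (fun t => aggMean W σ q₀ ν₀ o t i ω) atTop (𝓝 μ)} = 0) := by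
  refine ⟨fun _ L _ _ _ => if 0 < L then L else 1, fun _ L _ _ _ => ?_, ?_⟩
  · dsimp only
    split_ifs with hL
    exacts [hL, one_pos]
  intro N W ε c L U δ hε hc hL hLU _ hW hcol htrust
  have hnn : ∀ t i j, 0 ≤ W t i j := fun t => (hW.primitive t).nonneg
  have hLW : ∀ t i j, 0 < W t i j → L ≤ W t i j := fun t i j h => (hW.entries t i j h.ne').1
  refine ⟨fun t u v hu hv => ?_, fun hεL Ω _ P _ μ σ o q₀ ν₀ hσ ho hind hq i => ?_⟩
  · refine vecOneNorm_normalized_sub_le hL hε.le (hW.drift t) (hnn _) (hcol t) (hcol (t + 1))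
      (fun i j hij => ?_) hu hv
    obtain ⟨k, hk⟩ := htrust (t + 1) i j hij
    exact ⟨k, hLW _ _ _ (pos_of_mul_pos_left hk (hnn _ _ _)),
      hLW _ _ _ (pos_of_mul_pos_right hk (hnn _ _ _))⟩
  · replace hεL : ε < L := hεL.trans_eq (if_pos hL)
    choose s hs using hcol
    have hs0 : ∀ t, 0 ≤ s t := fun t => hs t i ▸ Finset.sum_nonneg fun j _ => hnn t j i
    have hsc : ∀ t, c ≤ s t := fun t =>
      (hW.radius t).trans (rho_le_of_sum_col_eq (hs0 t) (hnn t) (hs t))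
    have hU : 0 < U := hL.trans hLU
    have hsB : ∀ t, s t ≤ N * U := by
      intro t
      rw [← hs t i]
      have : ∑ _j : Fin N, U = N * U := by simp
      rw [← this]
      refine Finset.sum_le_sum fun j _ => ?_
      by_cases h0 : W t j i = 0
      · rw [h0]; exact hU.le
      · exact (hW.entries t j i h0).2
    obtain ⟨κ, hκ, T, hg⟩ := exists_mul_aggPrecision_le_impulse hc (div_pos hL hU)
      (hW.primitive 0) hnn (hW.mul_zero_le hL hLU hεL) hsc hsB hs σ hq i
    exact measure_tendsto_aggMean_eq_zero hσ ν₀ hnn hq hκ (fun t ht => hg t ht i) ho hind
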